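/- Let $\Gamma\subset\mathrm{PSL}_2(\mathbb R)$ be a Fuchsian group of the first kind with finite covolume (that is, $\Gamma$ is discrete and has a fundamental domain of finite hyperbolic area), acting on the upper half-plane $\mathbb H$ by fractional linear transformations. Let $M=\Gamma\backslash\mathbb H$ with projection $p:\mathbb H\to M$, let $d_{\mathrm{hyp}}$ be the hyperbolic distance on $\mathbb H$, and let $ds_{\mathrm{hyp}}=\sqrt{dx^2+dy^2}/y$. Let $\gamma\in\Gamma$ be hyperbolic and primitive (not of the form $\delta^n$ with $\delta\in\Gamma$, $n\ge 2$). Let $\sigma_\gamma\in\mathrm{PSL}_2(\mathbb R)$ and $\ell_\gamma>0$ be such that $\sigma_\gamma^{-1}\gamma\sigma_\gamma=\begin{pmatrix}e^{\ell_\gamma/2}&0\\0&e^{-\ell_\gamma/2}\end{pmatrix}$. Put $\mathcal L_\gamma=\sigma_\gamma\{z\in\mathbb H:\mathrm{Re}(z)=0\}$, let $L_\gamma$ be the closed geodesic $[0,\ell_\gamma]\ni\rho\mapsto p(\sigma_\gamma(e^{\rho}i))$ of length $\ell_\gamma$ on $M$ (integrals over $L_\gamma$ are taken along this closed curve, traversed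 once), and let $\Gamma_\gamma=\langle\gamma\rangle$. For $z,w\in\mathbb H$ and $s\in\mathbb C$ with $\mathrm{Re}(s)>1$ let $$K_s(z,w)=\sum_{\eta\in\Gamma}\cosh\bigl(d_{\mathrm{hyp}}(z,\eta w)\bigr)^{-s},\qquad \mathcal E^{\mathrm{hyp}}_\gamma(z,s)=\sum_{\eta\in\Gamma_\gamma\backslash\Gamma}\cosh\bigl(d_{\mathrm{hyp}}(\eta z,\mathcal L_\gamma)\bigr)^{-s},$$ which are $\Gamma$-invariant in each of the variables $z,w$ and hence are regarded as functions on $M\times M$ and $M$. Then $\Gamma_\gamma$ is the stabilizer (centralizer) of $\gamma$ in $\Gamma$, and for all $z,w\in M$ and $s\in\mathbb C$ with $\mathrm{Re}(s)>1$ both series converge absolutely, the function $w\mapsto K_s(z,w)$ is integrable along $L_\gamma$, and $$\int_{L_\gamma}K_s(z,w)\,ds_{\mathrm{hyp}}(w)=\frac{2^{s-1}\,\Gamma(\frac s2)^2}{\Gamma(s)}\;\mathcal E^{\mathrm{hyp}}_\gamma(z,s).$$ -/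

import Mathlib

open MeasureTheory UpperHalfPlane
open scoped MatrixGroups

noncomputable section

namespace HypEis

/-! ### The action of `PSL(2, ℝ)` on the upper half-plane -/

lemma center_smul (A : SL(2, ℝ)) (hA : A ∈ Subgroup.center SL(2, ℝ)) (z : ℍ) : A • z = z := by
  obtain ⟨r, hr, hA'⟩ := Matrix.SpecialLinearGroup.mem_center_iff.mp hA
  have hr0 : (r : ℂ) ≠ 0 := by
    intro h
    have : r = 0 := by exact_mod_cast h
    simp [this] at hr
  have h00 : A 0 0 = r := by rw [← hA']; simp
  have h01 : A 0 1 = 0 := by rw [← hA']; simp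
  have h10 : A 1 0 = 0 := by rw [← hA']; simp
  have h11 : A 1 1 = r := by rw [← hA']; simp
  apply UpperHalfPlane.ext
  rw [UpperHalfPlane.coe_specialLinearGroup_apply]
  simp [h00, h01, h10, h11]
  field_simp

/-- The homomorphism from `PSL(2, ℝ)` to permutations of `ℍ` induced by fractional linear
transformations. -/
def pslToPerm : PSL(2, ℝ) →* Equiv.Perm ℍ :=
  QuotientGroup.lift (Subgroup.center SL(2, ℝ)) (MulAction.toPermHom SL(2, ℝ) ℍ)
    (fun A hA => Equiv.ext fun z => center_smul A hA z)

/-- `PSL(2, ℝ)` acts on `ℍ` by fractional linear transformations. -/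
instance pslAction : MulAction PSL(2, ℝ) ℍ := MulAction.compHom ℍ pslToPerm

lemma mk_smul (A : SL(2, ℝ)) (z : ℍ) : (QuotientGroup.mk A : PSL(2, ℝ)) • z = A • z := rfl

instance pslIsometric : IsIsometricSMul PSL(2, ℝ) ℍ :=
  ⟨fun g => by
    induction g using QuotientGroup.induction_on with
    | H A => exact isometry_smul ℍ A⟩

/-! ### Fuchsian groups and the quotient surface -/

/-- `Γ` is a Fuchsian group of the first kind with finite volume quotient: it is discrete in
`PSL(2, ℝ)` and has a fundamental domain of finite hyperbolic area. -/
structure IsFuchsianFirstKind (Γ : Subgroup PSL(2, ℝ)) : Prop where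
  discrete : DiscreteTopology Γ
  finite_covolume : ∃ F : Set ℍ, IsFundamentalDomain Γ F (volume : Measure ℍ) ∧
    (volume : Measure ℍ) F < ⊤

/-- The surface `M = Γ \ ℍ`. -/
abbrev Surface (Γ : Subgroup PSL(2, ℝ)) : Type := MulAction.orbitRel.Quotient Γ ℍ

/-- The projection `p : ℍ → M`. -/
def proj (Γ : Subgroup PSL(2, ℝ)) (z : ℍ) : Surface Γ := Quotient.mk _ z

/-- An element of `PSL(2, ℝ)` is hyperbolic if its representatives in `SL(2, ℝ)` are, i.e. have
two distinct real eigenvalues. -/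
def IsHyperbolic (g : PSL(2, ℝ)) : Prop :=
  ∃ A : SL(2, ℝ), (QuotientGroup.mk A : PSL(2, ℝ)) = g ∧
    (A : Matrix (Fin 2) (Fin 2) ℝ).IsHyperbolic

/-- An element of `Γ` is primitive if it is not a proper power of an element of `Γ`. -/
def IsPrimitive {Γ : Subgroup PSL(2, ℝ)} (γ : Γ) : Prop :=
  ∀ (δ : Γ) (n : ℕ), 2 ≤ n → δ ^ n ≠ γ

/-! ### Scaling matrices, the axis and the closed geodesic -/

/-- The matrix `diag(e^{ℓ/2}, e^{-ℓ/2})`. -/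
def diagExp (ℓ : ℝ) : SL(2, ℝ) :=
  ⟨!![Real.exp (ℓ / 2), 0; 0, Real.exp (-ℓ / 2)], by
    rw [Matrix.det_fin_two_of, ← Real.exp_add]; simp [neg_div]⟩

/-- A scaling matrix for `γ`: an element `σ` of `PSL(2, ℝ)` with
`σ⁻¹ γ σ = diag(e^{ℓ/2}, e^{-ℓ/2})` for some `ℓ > 0`; the number `ℓ` is the length of the closed
geodesic determined by `γ`. -/
structure Scaling (γ : PSL(2, ℝ)) where
  σ : PSL(2, ℝ)
  ℓ : ℝ
  ℓ_pos : 0 < ℓ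
  conj_eq : σ⁻¹ * γ * σ = (QuotientGroup.mk (diagExp ℓ) : PSL(2, ℝ))

/-- The point `e^t i`. -/
def expI (t : ℝ) : ℍ := ⟨(Real.exp t : ℂ) * Complex.I, by
  rw [Complex.im_ofReal_mul]
  simpa using Real.exp_pos t⟩

/-- The positive `y`-axis. -/
def yAxis : Set ℍ := {z | z.re = 0}

/-- The geodesic `σ 𝓛` of `ℍ`, with `𝓛` the positive `y`-axis; it is the axis of `γ`. -/
def Scaling.axis {γ : PSL(2, ℝ)} (S : Scaling γ) : Set ℍ := (fun z : ℍ => S.σ • z) '' yAxis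

/-- The parametrization `t ↦ σ (e^t i)` of the axis of `γ`. Composed with the projection to `M` and
restricted to `[0, ℓ]`, it runs once through the closed geodesic determined by `γ`. -/
def Scaling.path {γ : PSL(2, ℝ)} (S : Scaling γ) (t : ℝ) : ℍ := S.σ • expI t

/-- The hyperbolic speed `√(x'² + y'²) / y` of a path `c = x + i y` in `ℍ`. -/
def hypSpeed (c : ℝ → ℍ) (t : ℝ) : ℝ := ‖deriv (fun u => (c u : ℂ)) t‖ / (c t).im

/-- The integrand `f ds_hyp` of the integral of a function on `M` along the projection of a path
in `ℍ`. -/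
def lineIntegrand (Γ : Subgroup PSL(2, ℝ)) (f : Surface Γ → ℂ) (c : ℝ → ℍ) (t : ℝ) : ℂ :=
  f (proj Γ (c t)) * (hypSpeed c t : ℂ)

/-- The integral `∫ f ds_hyp` over the closed geodesic determined by `γ`. -/
def closedGeodesicIntegral (Γ : Subgroup PSL(2, ℝ)) {γ : PSL(2, ℝ)} (S : Scaling γ)
    (f : Surface Γ → ℂ) : ℂ :=
  ∫ t in (0 : ℝ)..S.ℓ, lineIntegrand Γ f S.path t

/-! ### The automorphic kernel -/

/-- The term `cosh(d_hyp(z, η w))^{-s}`. -/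
def kernelTerm (Γ : Subgroup PSL(2, ℝ)) (s : ℂ) (z w : ℍ) (η : Γ) : ℂ :=
  (Real.cosh (dist z (η • w)) : ℂ) ^ (-s)

lemma kernel_wd (Γ : Subgroup PSL(2, ℝ)) (s : ℂ) (z w : ℍ) (g h : Γ) :
    ∑' η, kernelTerm Γ s (g • z) (h • w) η = ∑' η, kernelTerm Γ s z w η := by
  rw [← Equiv.tsum_eq ((Equiv.mulLeft g).trans (Equiv.mulRight h⁻¹))]
  refine tsum_congr fun η => ?_
  have : ((Equiv.mulLeft g).trans (Equiv.mulRight h⁻¹)) η = g * η * h⁻¹ := rfl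
  rw [kernelTerm, this, smul_smul, inv_mul_cancel_right, mul_smul, kernelTerm]
  have hd : dist (g • z) (g • (η • w)) = dist z (η • w) := dist_smul (g : PSL(2, ℝ)) z (η • w)
  rw [hd]

/-- The automorphic kernel `K_s(z, w) = ∑_{η ∈ Γ} cosh(d_hyp(z, η w))^{-s}` on `M × M`. -/
def kernel (Γ : Subgroup PSL(2, ℝ)) (s : ℂ) : Surface Γ → Surface Γ → ℂ :=
  Quotient.lift₂ (fun z w : ℍ => ∑' η, kernelTerm Γ s z w η) (by
    rintro _ _ z w ⟨g, rfl⟩ ⟨h, rfl⟩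
    exact kernel_wd Γ s z w g h)

/-! ### The hyperbolic Eisenstein series -/

lemma diagExp_smul_mem {ℓ : ℝ} {z : ℍ} (hz : z ∈ yAxis) : diagExp ℓ • z ∈ yAxis := by
  have hz' : (z : ℂ).re = 0 := hz
  change ((diagExp ℓ • z : ℍ) : ℂ).re = 0
  rw [UpperHalfPlane.coe_specialLinearGroup_apply]
  have e : (((Real.exp (ℓ / 2) : ℝ) : ℂ) * z) / ((Real.exp (-ℓ / 2) : ℝ) : ℂ)
      = ((Real.exp (ℓ / 2) / Real.exp (-ℓ / 2) : ℝ) : ℂ) * z := by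
    push_cast; ring
  simp only [diagExp, Matrix.of_apply, Matrix.cons_val', Matrix.cons_val_zero,
    Matrix.cons_val_one, Matrix.cons_val_fin_one, Algebra.algebraMap_self, RingHom.id_apply,
    Complex.ofReal_zero, add_zero, zero_mul, zero_add]
  rw [e, Complex.re_ofReal_mul, hz', mul_zero]

lemma diagExp_neg (ℓ : ℝ) : diagExp (-ℓ) = (diagExp ℓ)⁻¹ := by
  rw [Matrix.SpecialLinearGroup.SL2_inv_expl]
  ext i j
  fin_cases i <;> fin_cases j <;> simp [diagExp]

lemma Scaling.smul_mem_axis {γ : PSL(2, ℝ)} (S : Scaling γ) {z : ℍ} (hz : z ∈ S.axis) :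
    γ • z ∈ S.axis ∧ γ⁻¹ • z ∈ S.axis := by
  obtain ⟨w, hw, rfl⟩ := hz
  have h1 : γ = S.σ * (QuotientGroup.mk (diagExp S.ℓ) : PSL(2, ℝ)) * S.σ⁻¹ := by
    rw [← S.conj_eq]; group
  have h2 : γ⁻¹ = S.σ * (QuotientGroup.mk (diagExp (-S.ℓ)) : PSL(2, ℝ)) * S.σ⁻¹ := by
    rw [diagExp_neg, QuotientGroup.mk_inv, ← S.conj_eq]; group
  refine ⟨⟨diagExp S.ℓ • w, diagExp_smul_mem hw, ?_⟩,
    ⟨diagExp (-S.ℓ) • w, diagExp_smul_mem hw, ?_⟩⟩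
  · have h3 : γ * S.σ = S.σ * (QuotientGroup.mk (diagExp S.ℓ) : PSL(2, ℝ)) :=
      eq_mul_inv_iff_mul_eq.mp h1
    change S.σ • (diagExp S.ℓ • w) = γ • (S.σ • w)
    rw [← mk_smul, ← mul_smul, ← mul_smul, h3]
  · have h3 : γ⁻¹ * S.σ = S.σ * (QuotientGroup.mk (diagExp (-S.ℓ)) : PSL(2, ℝ)) :=
      eq_mul_inv_iff_mul_eq.mp h2
    change S.σ • (diagExp (-S.ℓ) • w) = γ⁻¹ • (S.σ • w)
    rw [← mk_smul, ← mul_smul, ← mul_smul, h3]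

lemma Scaling.image_axis {γ : PSL(2, ℝ)} (S : Scaling γ) :
    (fun z : ℍ => γ • z) '' S.axis = S.axis := by
  ext z
  refine ⟨?_, fun hz => ⟨γ⁻¹ • z, (S.smul_mem_axis hz).2, smul_inv_smul γ z⟩⟩
  rintro ⟨w, hw, rfl⟩
  exact (S.smul_mem_axis hw).1

lemma Scaling.infDist_zpow {γ : PSL(2, ℝ)} (S : Scaling γ) (g : PSL(2, ℝ))
    (hg : g ∈ Subgroup.zpowers γ) (z : ℍ) :
    Metric.infDist (g • z) S.axis = Metric.infDist z S.axis := by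
  have base : ∀ x : ℍ, Metric.infDist (γ • x) S.axis = Metric.infDist x S.axis := fun x => by
    conv_lhs => rw [← S.image_axis]
    exact Metric.infDist_image (isometry_smul ℍ γ)
  obtain ⟨n, rfl⟩ := hg
  change Metric.infDist (γ ^ n • z) S.axis = _
  induction n generalizing z with
  | zero => rw [zpow_zero, one_smul]
  | succ n ih => rw [zpow_add_one, mul_smul, ih, base]
  | pred n ih => rw [zpow_sub_one, mul_smul, ih, ← base (γ⁻¹ • z), smul_inv_smul]

/-- The subgroup `Γ_γ = ⟨γ⟩` of `Γ`. -/
abbrev stab {Γ : Subgroup PSL(2, ℝ)} (γ : Γ) : Subgroup Γ := Subgroup.zpowers γ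

/-- The coset space `Γ_γ \ Γ`, consisting of the cosets `Γ_γ η`. -/
abbrev Cosets {Γ : Subgroup PSL(2, ℝ)} (γ : Γ) : Type := Quotient (QuotientGroup.rightRel (stab γ))

/-- The term `cosh(d_hyp(η z, 𝓛_γ))^{-s}` as a function of the coset `Γ_γ η`. -/
def eisTerm {Γ : Subgroup PSL(2, ℝ)} {γ : Γ} (S : Scaling (γ : PSL(2, ℝ))) (s : ℂ) (z : ℍ) :
    Cosets γ → ℂ :=
  Quotient.lift (fun η : Γ => (Real.cosh (Metric.infDist (η • z) S.axis) : ℂ) ^ (-s)) (by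
    intro a b hab
    obtain ⟨n, hn⟩ := QuotientGroup.rightRel_apply.mp hab
    have hb : b = γ ^ n * a := by
      change γ ^ n = b * a⁻¹ at hn
      rw [hn]; group
    have h := S.infDist_zpow ((γ : PSL(2, ℝ)) ^ n) ⟨n, rfl⟩ (a • z)
    have e : b • z = ((γ : PSL(2, ℝ)) ^ n) • (a • z) := by
      rw [hb, mul_smul]; rfl
    simp only [e, h])

lemma eis_wd {Γ : Subgroup PSL(2, ℝ)} {γ : Γ} (S : Scaling (γ : PSL(2, ℝ))) (s : ℂ) (z : ℍ)
    (g : Γ) : ∑' η, eisTerm S s (g • z) η = ∑' η, eisTerm S s z η := by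
  have hr : ∀ a b : Γ, QuotientGroup.rightRel (stab γ) a b ↔
      QuotientGroup.rightRel (stab γ) (Equiv.mulRight g a) (Equiv.mulRight g b) := by
    intro a b
    rw [QuotientGroup.rightRel_apply, QuotientGroup.rightRel_apply]
    simp
  rw [← Equiv.tsum_eq (Quotient.congr (Equiv.mulRight g) hr) (eisTerm S s z)]
  refine tsum_congr fun η => ?_
  induction η using Quotient.inductionOn with
  | h a =>
    change (Real.cosh (Metric.infDist (a • g • z) S.axis) : ℂ) ^ (-s) =
      (Real.cosh (Metric.infDist ((a * g) • z) S.axis) : ℂ) ^ (-s)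
    rw [mul_smul]

/-- The hyperbolic Eisenstein series `∑_{η ∈ Γ_γ \ Γ} cosh(d_hyp(η z, 𝓛_γ))^{-s}` on `M`. -/
def eisenstein {Γ : Subgroup PSL(2, ℝ)} {γ : Γ} (S : Scaling (γ : PSL(2, ℝ))) (s : ℂ) :
    Surface Γ → ℂ :=
  Quotient.lift (fun z : ℍ => ∑' η, eisTerm S s z η) (by
    rintro _ z ⟨g, rfl⟩
    exact eis_wd S s z g)

/-! ### Every hyperbolic element has a scaling matrix -/

lemma Scaling.of_mul {A σ : SL(2, ℝ)} {ℓ : ℝ} (h : 0 < ℓ) (e : A.1 * σ.1 = σ.1 * (diagExp ℓ).1) :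
    Nonempty (Scaling (QuotientGroup.mk A : PSL(2, ℝ))) := by
  refine ⟨⟨QuotientGroup.mk σ, ℓ, h, ?_⟩⟩
  rw [← QuotientGroup.mk_inv, ← QuotientGroup.mk_mul, ← QuotientGroup.mk_mul, mul_assoc,
    show A * σ = σ * diagExp ℓ from Subtype.ext e, inv_mul_cancel_left]

lemma exists_scaling_aux (A : SL(2, ℝ)) (hA : 2 < A 0 0 + A 1 1) :
    Nonempty (Scaling (QuotientGroup.mk A : PSL(2, ℝ))) := by
  induction A using Matrix.SpecialLinearGroup.fin_two_induction with
  | _ a b c d hdet =>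
  replace hA : 2 < a + d := by simpa using hA
  obtain ⟨l, hl, hsum⟩ : ∃ l : ℝ, 1 < l ∧ l + l⁻¹ = a + d := by
    have h4 : 0 < (a + d) ^ 2 - 4 := by nlinarith
    have hs := Real.sq_sqrt h4.le
    have hs0 := Real.sqrt_pos.mpr h4
    set r := √((a + d) ^ 2 - 4)
    refine ⟨(a + d + r) / 2, by linarith, ?_⟩
    have hne : a + d + r ≠ 0 := by linarith
    field_simp
    nlinarith
  have hl0 : l ≠ 0 := by linarith
  have hlinv : l⁻¹ < 1 := inv_lt_one_of_one_lt₀ hl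
  have hm : l * l⁻¹ = 1 := mul_inv_cancel₀ hl0
  have he1 : Real.exp (2 * Real.log l / 2) = l := by
    rw [mul_div_cancel_left₀ _ (two_ne_zero), Real.exp_log (by linarith)]
  have he2 : Real.exp (-(2 * Real.log l) / 2) = l⁻¹ := by
    rw [neg_div, Real.exp_neg, he1]
  have hpos : 0 < 2 * Real.log l := by have := Real.log_pos hl; linarith
  generalize l⁻¹ = m at *
  by_cases hc : c = 0
  · subst hc
    have hfac : (a - l) * (a - m) = 0 := by
      have hd : d = l + m - a := by linarith
      subst hd
      linear_combination hm - hdet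
    rcases mul_eq_zero.mp hfac with h | h
    · have ha : a = l := by linarith
      have hd : d = m := by linarith
      have hne : m - l ≠ 0 := by linarith
      refine Scaling.of_mul (σ := ⟨!![1, b / (m - l); 0, 1], by simp⟩) hpos ?_
      simp only [diagExp, Matrix.mul_fin_two, he1, he2, ha, hd]
      ext i j
      fin_cases i <;> fin_cases j <;> simp
      field_simp
      ring
    · have ha : a = m := by linarith
      have hd : d = l := by linarith
      have hne : l - m ≠ 0 := by linarith
      refine Scaling.of_mul (σ := ⟨!![b / (l - m), -1; 1, 0], by simp⟩) hpos ?_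
      simp only [diagExp, Matrix.mul_fin_two, he1, he2, ha, hd]
      ext i j
      fin_cases i <;> fin_cases j <;> simp
      field_simp
      ring
  · have hne : l - m ≠ 0 := by linarith
    refine Scaling.of_mul
      (σ := ⟨!![(l - d) / (c * (l - m)), m - d; 1 / (l - m), c], by
        rw [Matrix.det_fin_two_of]; field_simp; ring⟩) hpos ?_
    simp only [diagExp, Matrix.mul_fin_two, he1, he2]
    have ha : a = l + m - d := by linarith
    subst ha
    have hb : b * c = (l + m - d) * d - l * m := by linarith
    ext i j
    fin_cases i <;> fin_cases j <;> simp
    · field_simp; linear_combination hb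
    · linear_combination hb
    · field_simp; ring
    · ring

/-- Every hyperbolic element of `PSL(2, ℝ)` has a scaling matrix. -/
theorem IsHyperbolic.nonempty_scaling {g : PSL(2, ℝ)} (hg : IsHyperbolic g) :
    Nonempty (Scaling g) := by
  obtain ⟨A, rfl, hA⟩ := hg
  have hA' : 0 < (A 0 0 + A 1 1) ^ 2 - 4 := by
    have := hA
    rw [Matrix.IsHyperbolic, Matrix.discr_fin_two, Matrix.SpecialLinearGroup.det_coe,
      Matrix.trace_fin_two] at this
    simpa using this
  rcases le_or_gt 0 (A 0 0 + A 1 1) with h | h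
  · exact exists_scaling_aux A (by nlinarith)
  · have h2 : (QuotientGroup.mk A : PSL(2, ℝ)) = QuotientGroup.mk (-A) := by
      rw [QuotientGroup.eq]
      have : A⁻¹ * -A = -1 := by simp
      rw [this]
      exact Subgroup.mem_center_iff.mpr fun B => by simp
    rw [h2]
    refine exists_scaling_aux (-A) ?_
    simp
    nlinarith

end HypEis

end

open HypEis

namespace HypEis

/-! ### The integral of a power of the hyperbolic cosine -/

/-! The formula is an unfolding. Each element of Γ is uniquely `a⁻¹ γ ^ n`, with `a` running over
representatives of Γ_γ \ Γ (`bijective_inv_out_mul_zpow`). Since `γ ^ n` shifts the parameter of the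
axis by `n ℓ`, the integrals over `[0, ℓ]` belonging to one coset add up to an integral over the
whole axis. There hyperbolic Pythagoras (`Scaling.cosh_dist_path`) gives cosh d(az, path t) = cosh
d(az, axis) · cosh (t - c), so the coset contributes its Eisenstein term times ∫ cosh^(-s). That
last integral is a beta integral with both parameters `s / 2` (`integral_cosh_cpow`).

Interchanging sum and integral requires the Poincaré series to converge for Re s > 1
(`summable_cosh_dist_rpow`). Its terms are compared with integrals over unit balls around the orbit
points; these balls overlap boundedly often, and cosh(d)^(-σ) has finite integral over ℍ.
Summability over Γ passes to the cosets, so the Eisenstein series converges because the gamma factor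
is nonzero.

For the centralizer: whatever commutes with `γ` translates along its axis, discreteness makes these
translations cyclic, and primitivity forces `γ` to be a generator (`stab_eq_centralizer`). -/

lemma sigmoid_mul_one_sub_sigmoid (t : ℝ) :
    Real.sigmoid (2 * t) * (1 - Real.sigmoid (2 * t)) = ((2 * Real.cosh t) ^ 2)⁻¹ := by
  rw [← Real.sigmoid_neg, Real.sigmoid_def, Real.sigmoid_def, Real.cosh_eq, neg_neg, ← mul_inv]
  congr 1
  have h1 : Real.exp (2 * t) = Real.exp t ^ 2 := by rw [← Real.exp_nat_mul]; norm_num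
  have h2 : Real.exp (-(2 * t)) = Real.exp (-t) ^ 2 := by
    rw [← Real.exp_nat_mul]; congr 1; push_cast; ring
  have h3 : Real.exp t * Real.exp (-t) = 1 := by rw [← Real.exp_add]; simp
  rw [h1, h2]
  -- The two sides differ by the square of `exp t * exp (-t) - 1`.
  linear_combination (Real.exp t * Real.exp (-t) - 1) * h3

/-- Substituting x = sigmoid (2t) in the beta integral, the Jacobian 2x(1-x) cancels the -1 in both
exponents and leaves 2(x(1-x))^(s/2), where x(1-x) = (2 cosh t)^(-2). -/
lemma betaIntegrand_sigmoid (s : ℂ) (t : ℝ) :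
    |2 * (Real.sigmoid (2 * t) * (1 - Real.sigmoid (2 * t)))| •
      (((Real.sigmoid (2 * t) : ℝ) : ℂ) ^ (s / 2 - 1) *
        (1 - ((Real.sigmoid (2 * t) : ℝ) : ℂ)) ^ (s / 2 - 1)) =
      (2 : ℂ) ^ (1 - s) * (Real.cosh t : ℂ) ^ (-s) := by
  have hx := Real.sigmoid_pos (2 * t)
  have hy : 0 < 1 - Real.sigmoid (2 * t) := by linarith [Real.sigmoid_lt_one (2 * t)]
  have key := sigmoid_mul_one_sub_sigmoid t
  have hc := Real.cosh_pos t
  set x := Real.sigmoid (2 * t)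
  have hxy : 0 < x * (1 - x) := mul_pos hx hy
  have hne : ((x * (1 - x) : ℝ) : ℂ) ≠ 0 := by exact_mod_cast hxy.ne'
  have e1 : (x : ℂ) ^ (s / 2 - 1) * (1 - (x : ℂ)) ^ (s / 2 - 1) =
      ((x * (1 - x) : ℝ) : ℂ) ^ (s / 2 - 1) := by
    rw [Complex.ofReal_mul, Complex.mul_cpow_ofReal_nonneg hx.le hy.le]; push_cast; rfl
  rw [e1, abs_of_pos (by positivity), Complex.real_smul, Complex.cpow_sub _ _ hne, Complex.cpow_one,
    Complex.ofReal_mul]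
  have e2 : ((x * (1 - x) : ℝ) : ℂ) ^ (s / 2) = (2 : ℂ) ^ (-s) * (Real.cosh t : ℂ) ^ (-s) := by
    have h2 : (0 : ℝ) < 2 * Real.cosh t := by positivity
    have e3 : (2 : ℂ) ^ (-s) * (Real.cosh t : ℂ) ^ (-s) = ((2 * Real.cosh t : ℝ) : ℂ) ^ (-s) := by
      rw [Complex.ofReal_mul, Complex.mul_cpow_ofReal_nonneg (by norm_num) hc.le]; norm_num
    rw [e3, key, Complex.cpow_def_of_ne_zero (by exact_mod_cast (inv_pos.2 (pow_pos h2 2)).ne'),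
      Complex.cpow_def_of_ne_zero (by exact_mod_cast h2.ne'), ← Complex.ofReal_log (by positivity),
      ← Complex.ofReal_log h2.le, Real.log_inv, Real.log_pow]
    congr 1; push_cast; ring
  rw [e2, Complex.cpow_sub _ _ two_ne_zero, Complex.cpow_one]
  rw [Complex.ofReal_ofNat, show (2 : ℂ) ^ (-s) = ((2 : ℂ) ^ s)⁻¹ from Complex.cpow_neg 2 s]
  generalize ((x * (1 - x) : ℝ) : ℂ) = y at hne
  field_simp

lemma hasDerivAt_sigmoid_two_mul (t : ℝ) :
    HasDerivAt (fun t => Real.sigmoid (2 * t))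
      (2 * (Real.sigmoid (2 * t) * (1 - Real.sigmoid (2 * t)))) t := by
  have := (Real.hasDerivAt_sigmoid (2 * t)).comp t ((hasDerivAt_id t).const_mul 2)
  refine this.congr_deriv ?_
  ring

lemma image_sigmoid_two_mul : (fun t : ℝ => Real.sigmoid (2 * t)) '' Set.univ = Set.Ioo 0 1 := by
  rw [← Real.range_sigmoid, Set.image_univ]
  ext y
  constructor
  · rintro ⟨t, rfl⟩; exact ⟨2 * t, rfl⟩
  · rintro ⟨t, rfl⟩; exact ⟨t / 2, by simp only; congr 1; ring⟩

lemma injective_sigmoid_two_mul : Function.Injective (fun t : ℝ => Real.sigmoid (2 * t)) :=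
  fun a b h => by have := Real.sigmoid_injective h; linarith

lemma integrable_cosh_cpow {s : ℂ} (hs : 0 < s.re) :
    Integrable (fun t : ℝ => (Real.cosh t : ℂ) ^ (-s)) := by
  have hs2 : 0 < (s / 2).re := by simpa using hs
  have h := Complex.betaIntegral_convergent hs2 hs2
  rw [intervalIntegrable_iff_integrableOn_Ioo_of_le zero_le_one, ← image_sigmoid_two_mul,
    integrableOn_image_iff_integrableOn_abs_deriv_smul MeasurableSet.univ
      (fun t _ => (hasDerivAt_sigmoid_two_mul t).hasDerivWithinAt)
      injective_sigmoid_two_mul.injOn] at h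
  simp only [betaIntegrand_sigmoid, integrableOn_univ] at h
  have h2 : (2 : ℂ) ^ (1 - s) ≠ 0 := by simp [Complex.cpow_eq_zero_iff]
  exact (integrable_const_mul_iff (IsUnit.mk0 _ h2) _).1 h

lemma integral_cosh_cpow {s : ℂ} (hs : 0 < s.re) :
    ∫ t : ℝ, (Real.cosh t : ℂ) ^ (-s) =
      (2 : ℂ) ^ (s - 1) * Complex.Gamma (s / 2) ^ 2 / Complex.Gamma s := by
  have hs2 : 0 < (s / 2).re := by simpa using hs
  have h := Complex.Gamma_mul_Gamma_eq_betaIntegral hs2 hs2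
  rw [Complex.betaIntegral, intervalIntegral.integral_of_le zero_le_one,
    integral_Ioc_eq_integral_Ioo, ← image_sigmoid_two_mul,
    integral_image_eq_integral_abs_deriv_smul MeasurableSet.univ
      (fun t _ => (hasDerivAt_sigmoid_two_mul t).hasDerivWithinAt)
      injective_sigmoid_two_mul.injOn] at h
  simp only [betaIntegrand_sigmoid, Measure.restrict_univ, integral_const_mul, add_halves] at h
  rw [sq, h, show (2 : ℂ) ^ (1 - s) = ((2 : ℂ) ^ (s - 1))⁻¹ by rw [← Complex.cpow_neg, neg_sub]]
  have h2 : (2 : ℂ) ^ (s - 1) ≠ 0 := by simp [Complex.cpow_eq_zero_iff]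
  have h3 : Complex.Gamma s ≠ 0 := Complex.Gamma_ne_zero_of_re_pos hs
  field_simp

/-! ### Geometry of the axis -/

lemma coe_expI (t : ℝ) : (expI t : ℂ) = (Real.exp t : ℂ) * Complex.I := rfl

lemma expI_re (t : ℝ) : (expI t).re = 0 := by
  change ((expI t : ℂ)).re = 0
  simp [coe_expI, -Complex.ofReal_exp]

lemma expI_im (t : ℝ) : (expI t).im = Real.exp t := by
  change ((expI t : ℂ)).im = _
  simp [coe_expI, -Complex.ofReal_exp]

lemma dist_expI_expI (t u : ℝ) : dist (expI t) (expI u) = |t - u| := by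
  rw [UpperHalfPlane.dist_of_re_eq (by rw [expI_re, expI_re]), expI_im, expI_im, Real.log_exp,
    Real.log_exp, Real.dist_eq]

lemma yAxis_eq_range : yAxis = Set.range expI := by
  ext z
  constructor
  · intro hz
    refine ⟨Real.log z.im, UpperHalfPlane.ext_re_im ?_ ?_⟩
    · rw [expI_re]; exact hz.symm
    · rw [expI_im, Real.exp_log z.im_pos]
  · rintro ⟨t, rfl⟩; exact expI_re t

/-- Pythagoras for the right triangle whose right angle is at `i‖w‖`, the foot of the perpendicular
from `w` to the imaginary axis. -/
lemma cosh_dist_expI (w : ℍ) (t : ℝ) :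
    Real.cosh (dist w (expI t)) = ‖(w : ℂ)‖ / w.im * Real.cosh (t - Real.log ‖(w : ℂ)‖) := by
  have hw : 0 < ‖(w : ℂ)‖ := norm_pos_iff.2 w.ne_zero
  have hsq : ‖(w : ℂ)‖ ^ 2 = w.re ^ 2 + w.im ^ 2 := by
    rw [← Complex.normSq_eq_norm_sq, Complex.normSq_apply]; simp; ring
  have him := w.im_pos
  have het := Real.exp_pos t
  rw [UpperHalfPlane.cosh_dist', expI_re, expI_im, Real.cosh_eq, neg_sub, Real.exp_sub,
    Real.exp_sub, Real.exp_log hw]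
  field_simp
  rw [hsq]; ring

lemma cosh_infDist_yAxis (w : ℍ) :
    Real.cosh (Metric.infDist w yAxis) = ‖(w : ℂ)‖ / w.im := by
  have hw : 0 < ‖(w : ℂ)‖ := norm_pos_iff.2 w.ne_zero
  have h0 : Real.cosh (dist w (expI (Real.log ‖(w : ℂ)‖))) = ‖(w : ℂ)‖ / w.im := by
    rw [cosh_dist_expI]; simp
  rw [← h0]
  congr 1
  apply le_antisymm
  · exact Metric.infDist_le_dist_of_mem (by rw [yAxis_eq_range]; exact ⟨_, rfl⟩)
  · rw [yAxis_eq_range]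
    refine (Metric.le_infDist (Set.range_nonempty _)).2 ?_
    rintro _ ⟨t, rfl⟩
    have : Real.cosh (dist w (expI (Real.log ‖(w : ℂ)‖))) ≤ Real.cosh (dist w (expI t)) := by
      rw [h0, cosh_dist_expI]
      exact le_mul_of_one_le_right (div_nonneg hw.le w.im_pos.le) (Real.one_le_cosh _)
    rw [Real.cosh_le_cosh, abs_of_nonneg dist_nonneg, abs_of_nonneg dist_nonneg] at this
    exact this

section Scaling

variable {γ : PSL(2, ℝ)} (S : Scaling γ)

lemma dist_smul_left_eq (g : PSL(2, ℝ)) (z w : ℍ) : dist z (g • w) = dist (g⁻¹ • z) w := by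
  rw [← dist_smul g (g⁻¹ • z) w, smul_inv_smul]

lemma Scaling.dist_path (z : ℍ) (t : ℝ) : dist z (S.path t) = dist (S.σ⁻¹ • z) (expI t) :=
  dist_smul_left_eq _ _ _

lemma Scaling.infDist_axis (z : ℍ) :
    Metric.infDist z S.axis = Metric.infDist (S.σ⁻¹ • z) yAxis := by
  rw [Scaling.axis, ← Metric.infDist_image (x := S.σ⁻¹ • z) (t := yAxis) (isometry_smul ℍ S.σ),
    smul_inv_smul]

/-- The distance to a point of the axis in terms of the distance to the axis. -/
lemma Scaling.cosh_dist_path (z : ℍ) (t : ℝ) :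
    Real.cosh (dist z (S.path t)) = Real.cosh (Metric.infDist z S.axis) *
      Real.cosh (t - Real.log ‖((S.σ⁻¹ • z : ℍ) : ℂ)‖) := by
  rw [S.dist_path, S.infDist_axis, cosh_dist_expI, cosh_infDist_yAxis]

lemma Scaling.dist_path_path (t u : ℝ) : dist (S.path t) (S.path u) = |t - u| := by
  rw [Scaling.path, Scaling.path, dist_smul, dist_expI_expI]

lemma Scaling.continuous_path : Continuous S.path := by
  refine (Isometry.of_dist_eq fun t u => ?_).continuous
  rw [S.dist_path_path, Real.dist_eq]

lemma diagExp_smul_expI (ℓ t : ℝ) : diagExp ℓ • expI t = expI (t + ℓ) := by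
  apply UpperHalfPlane.ext
  rw [UpperHalfPlane.coe_specialLinearGroup_apply, coe_expI, coe_expI]
  simp [diagExp, -Complex.ofReal_exp]
  have h : Real.exp (t + ℓ) = Real.exp (ℓ / 2) * Real.exp t / Real.exp (-ℓ / 2) := by
    rw [← Real.exp_add, ← Real.exp_sub]; congr 1; ring
  rw [h]; push_cast; ring

lemma Scaling.smul_path (t : ℝ) : γ • S.path t = S.path (t + S.ℓ) := by
  have h : γ * S.σ = S.σ * (QuotientGroup.mk (diagExp S.ℓ) : PSL(2, ℝ)) := by
    rw [← S.conj_eq]; group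
  rw [Scaling.path, Scaling.path, ← mul_smul, h, mul_smul, mk_smul, diagExp_smul_expI]

lemma Scaling.zpow_smul_path (n : ℤ) (t : ℝ) : γ ^ n • S.path t = S.path (t + n * S.ℓ) := by
  induction n generalizing t with
  | zero => simp
  | succ n ih => rw [zpow_add_one, mul_smul, S.smul_path, ih]; congr 1; push_cast; ring
  | pred n ih =>
    have h : γ⁻¹ • S.path t = S.path (t - S.ℓ) := by
      rw [inv_smul_eq_iff, S.smul_path, sub_add_cancel]
    rw [zpow_sub_one, mul_smul, h, ih]; congr 1; push_cast; ring

/-- A Möbius map scales both the derivative and the imaginary part by |cz + d|^(-2), so it preserves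
speed. The curve `e^t i` is its own derivative, which gives speed 1. -/
lemma Scaling.hypSpeed_path (t : ℝ) : hypSpeed S.path t = 1 := by
  obtain ⟨A, hA⟩ := QuotientGroup.mk_surjective S.σ
  have hp : ∀ u, S.path u = A • expI u := fun u => by rw [Scaling.path, ← hA]; rfl
  have hdet : (A 0 0 : ℂ) * A 1 1 - A 0 1 * A 1 0 = 1 := by
    have := A.det_coe
    rw [Matrix.det_fin_two] at this
    exact_mod_cast this
  have hden : ∀ u, (A 1 0 : ℂ) * expI u + A 1 1 ≠ 0 := fun u => by
    have := UpperHalfPlane.denom_ne_zero (A : GL (Fin 2) ℝ) (expI u)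
    simpa [UpperHalfPlane.denom] using this
  have he : HasDerivAt (fun u : ℝ => (expI u : ℂ)) (expI t : ℂ) t := by
    simp only [coe_expI]
    exact ((Real.hasDerivAt_exp t).ofReal_comp).mul_const _
  have hd : HasDerivAt (fun u : ℝ => (S.path u : ℂ))
      ((expI t : ℂ) / ((A 1 0 : ℂ) * expI t + A 1 1) ^ 2) t := by
    have h1 := (((he.const_mul (A 0 0 : ℂ)).add_const (A 0 1 : ℂ)).div
      ((he.const_mul (A 1 0 : ℂ)).add_const (A 1 1 : ℂ)) (hden t))
    have h2 : (fun u : ℝ => (S.path u : ℂ)) = fun u : ℝ =>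
        ((A 0 0 : ℂ) * expI u + A 0 1) / ((A 1 0 : ℂ) * expI u + A 1 1) := by
      funext u
      rw [hp, UpperHalfPlane.coe_specialLinearGroup_apply]
      simp
    rw [h2]
    refine h1.congr_deriv ?_
    congr 1
    linear_combination (expI t : ℂ) * hdet
  have him : (S.path t).im = Real.exp t / ‖(A 1 0 : ℂ) * expI t + A 1 1‖ ^ 2 := by
    rw [hp, MulAction.compHom_smul_def, UpperHalfPlane.im_smul_eq_div_normSq,
      Complex.normSq_eq_norm_sq, expI_im]
    simp [UpperHalfPlane.denom]
  have hn : ‖(expI t : ℂ)‖ = Real.exp t := by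
    rw [coe_expI]; simp
  rw [hypSpeed, hd.deriv, him, norm_div, norm_pow, hn]
  have := norm_pos_iff.2 (hden t)
  have := Real.exp_pos t
  field_simp

end Scaling

/-! ### Discrete groups act properly discontinuously -/

/-- A closed centre makes the quotient Hausdorff, and in a Hausdorff group discrete subgroups are
closed. -/
instance isClosed_center_SL : IsClosed (Subgroup.center SL(2, ℝ) : Set SL(2, ℝ)) := by
  have : (Subgroup.center SL(2, ℝ) : Set SL(2, ℝ)) = ⋂ B : SL(2, ℝ), {A | B * A = A * B} := by
    ext A
    simp [Subgroup.mem_center_iff]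
  rw [this]
  exact isClosed_iInter fun B => isClosed_eq (by fun_prop) (by fun_prop)

instance t2Space_PSL : T2Space PSL(2, ℝ) :=
  have : T3Space PSL(2, ℝ) := QuotientGroup.instT3Space (Subgroup.center SL(2, ℝ))
  inferInstance

/-- The orbit map of `I` under `SL(2, ℝ)` is proper. Changing the base point to `w` costs at most `2
* dist I w`, and compactness descends to the quotient. -/
lemma isCompact_setOf_dist_smul_le (w : ℍ) (r : ℝ) :
    IsCompact {g : PSL(2, ℝ) | dist w (g • w) ≤ r} := by
  have h1 : IsCompact {A : SL(2, ℝ) | dist I (A • I) ≤ r + 2 * dist I w} := by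
    have := isProperMap_smul_I.isCompact_preimage
      (isCompact_closedBall I (r + 2 * dist I w))
    refine this.of_isClosed_subset ?_ fun A hA => ?_
    · exact isClosed_le (by fun_prop) continuous_const
    · rw [Set.mem_preimage, Metric.mem_closedBall, dist_comm]; exact hA
  have h2 : IsCompact {A : SL(2, ℝ) | dist w (A • w) ≤ r} := by
    refine h1.of_isClosed_subset (isClosed_le (by fun_prop) continuous_const) fun A hA => ?_
    have t1 := dist_triangle4 I w (A • w) (A • I)
    have t2 : dist (A • w) (A • I) = dist w I := dist_smul A w I
    rw [t2, dist_comm w I] at t1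
    change dist I (A • I) ≤ _
    have : dist w (A • w) ≤ r := hA
    linarith
  convert h2.image (QuotientGroup.continuous_mk (N := Subgroup.center SL(2, ℝ)))
  ext g
  constructor
  · intro hg
    obtain ⟨A, rfl⟩ := QuotientGroup.mk_surjective g
    exact ⟨A, hg, rfl⟩
  · rintro ⟨A, hA, rfl⟩; exact hA

section Discrete

variable (Γ : Subgroup PSL(2, ℝ)) [DiscreteTopology Γ]

lemma finite_setOf_dist_smul_le (w : ℍ) (r : ℝ) : {η : Γ | dist w (η • w) ≤ r}.Finite := by
  have hc : IsClosed (Γ : Set PSL(2, ℝ)) := Subgroup.isClosed_of_discrete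
  exact isCompact_iff_finite.1
    (hc.isClosedEmbedding_subtypeVal.isCompact_preimage (isCompact_setOf_dist_smul_le w r))

lemma countable_of_discrete : Countable Γ := by
  have : (Set.univ : Set Γ) = ⋃ n : ℕ, {η : Γ | dist I (η • I) ≤ n} := by
    ext η
    simpa using exists_nat_ge (dist I (η • I))
  rw [← Set.countable_univ_iff, this]
  exact Set.countable_iUnion fun n => (finite_setOf_dist_smul_le Γ I n).countable

/-- The number of translates of `w` in a unit ball is bounded. -/
lemma exists_card_le (w : ℍ) : ∃ N : ℕ, ∀ u : ℍ, ∃ T : Finset Γ,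
    (∀ η : Γ, u ∈ Metric.ball (η • w) 1 → η ∈ T) ∧ T.card ≤ N := by
  classical
  -- Two translates within distance 1 of the same `u` are within 2 of each other, so all of them
  -- arise from `F` through a single `η₀`.
  set F := (finite_setOf_dist_smul_le Γ w 2).toFinset with hF
  refine ⟨F.card, fun u => ?_⟩
  by_cases h : ∃ η₀ : Γ, u ∈ Metric.ball (η₀ • w) 1
  · obtain ⟨η₀, h₀⟩ := h
    refine ⟨F.image (η₀ * ·), fun η hη => ?_, Finset.card_image_le⟩
    refine Finset.mem_image.2 ⟨η₀⁻¹ * η, ?_, by simp⟩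
    rw [hF, Set.Finite.mem_toFinset, Set.mem_ofPred_eq]
    have e : dist (η₀ • w) (η₀ • ((η₀⁻¹ * η) • w)) = dist w ((η₀⁻¹ * η) • w) :=
      dist_smul (η₀ : PSL(2, ℝ)) w ((η₀⁻¹ * η) • w)
    rw [← e, smul_smul, mul_inv_cancel_left]
    have := dist_triangle_left (η₀ • w) (η • w) u
    rw [Metric.mem_ball] at h₀ hη
    linarith
  · push Not at h
    exact ⟨∅, fun η hη => absurd hη (h η), by simp⟩

end Discrete

/-! ### Integrability of powers of the hyperbolic cosine of the distance -/

/-- The two sides differ by `cosh (a - b)`. -/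
lemma cosh_add_le (a b : ℝ) : Real.cosh (a + b) ≤ 2 * Real.cosh a * Real.cosh b := by
  rw [Real.cosh_add]
  have h : Real.cosh (a - b) = Real.cosh a * Real.cosh b - Real.sinh a * Real.sinh b :=
    Real.cosh_sub a b
  have := Real.cosh_pos (a - b)
  linarith

lemma cosh_dist_triangle {X : Type*} [PseudoMetricSpace X] (x y z : X) :
    Real.cosh (dist x z) ≤ 2 * Real.cosh (dist y z) * Real.cosh (dist x y) := by
  refine le_trans ?_ (cosh_add_le _ _)
  rw [Real.cosh_le_cosh, abs_of_nonneg dist_nonneg, abs_of_nonneg (by positivity), add_comm]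
  exact dist_triangle x y z

/-- Moving one of the two points changes `cosh (dist x y) ^ (-σ)` by a bounded factor. -/
lemma cosh_dist_rpow_le {X : Type*} [PseudoMetricSpace X] {σ : ℝ} (hσ : 0 ≤ σ) {r : ℝ}
    (x y z : X) (h : dist y z ≤ r) :
    Real.cosh (dist x y) ^ (-σ) ≤ (2 * Real.cosh r) ^ σ * Real.cosh (dist x z) ^ (-σ) := by
  have h1 := Real.cosh_pos (dist x y)
  have h2 := Real.cosh_pos (dist x z)
  have hr : Real.cosh (dist y z) ≤ Real.cosh r := by
    rw [Real.cosh_le_cosh, abs_of_nonneg dist_nonneg]; exact h.trans (le_abs_self r)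
  have h3 : 0 < 2 * Real.cosh r := by have := Real.cosh_pos r; positivity
  have h4 : Real.cosh (dist x z) ≤ 2 * Real.cosh r * Real.cosh (dist x y) := by
    refine (cosh_dist_triangle x y z).trans ?_
    gcongr
  rw [Real.rpow_neg h1.le, Real.rpow_neg h2.le, ← div_eq_mul_inv, inv_eq_one_div,
    div_le_div_iff₀ (by positivity) (by positivity), one_mul, ← Real.mul_rpow h3.le h1.le]
  exact Real.rpow_le_rpow h2.le h4 hσ

/-- Near 0 the factor `y ^ (σ - 2)` is integrable because `σ > 1`; beyond 1 the integrand is at most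
`y ^ (-2)`. -/
lemma integrableOn_rpow_mul_one_add_sq_rpow {σ : ℝ} (hσ : 1 < σ) :
    IntegrableOn (fun y : ℝ => y ^ (σ - 2) * (1 + y ^ 2) ^ (-σ / 2)) (Set.Ioi 0) := by
  have hm : Measurable (fun y : ℝ => y ^ (σ - 2) * (1 + y ^ 2) ^ (-σ / 2)) := by fun_prop
  rw [← Set.Ioc_union_Ioi_eq_Ioi zero_le_one]
  refine IntegrableOn.union ?_ ?_
  · have h : IntegrableOn (fun y : ℝ => y ^ (σ - 2)) (Set.Ioc 0 1) :=
      (intervalIntegrable_iff_integrableOn_Ioc_of_le zero_le_one).1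
        (intervalIntegral.intervalIntegrable_rpow' (by linarith))
    refine Integrable.mono' h hm.aestronglyMeasurable ?_
    refine (ae_restrict_iff' measurableSet_Ioc).2 (Filter.Eventually.of_forall fun y hy => ?_)
    have hy0 : 0 < y := hy.1
    rw [Real.norm_of_nonneg (by positivity)]
    refine mul_le_of_le_one_right (by positivity) ?_
    exact Real.rpow_le_one_of_one_le_of_nonpos (by nlinarith) (by linarith)
  · have h := integrableOn_Ioi_rpow_of_lt (a := -2) (c := 1) (by norm_num) one_pos
    refine Integrable.mono' h hm.aestronglyMeasurable ?_
    refine (ae_restrict_iff' measurableSet_Ioi).2 (Filter.Eventually.of_forall fun y hy => ?_)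
    have hy0 : 0 < y := lt_trans one_pos hy
    rw [Real.norm_of_nonneg (by positivity)]
    have e : y ^ (-2 : ℝ) = y ^ (σ - 2) * (y ^ 2) ^ (-σ / 2) := by
      rw [← Real.rpow_natCast, ← Real.rpow_mul hy0.le, ← Real.rpow_add hy0]
      congr 1; push_cast; ring
    rw [e]
    refine mul_le_mul_of_nonneg_left ?_ (by positivity)
    exact Real.rpow_le_rpow_of_nonpos (by positivity) (by linarith) (by linarith)

/-- The density of `cosh (dist i u) ^ (-σ) dμ(u)` is dominated by a product. -/
lemma cosh_dist_I_rpow_le {σ : ℝ} (hσ : 0 < σ) (u : ℍ) :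
    (1 / u.im) ^ 2 * Real.cosh (dist I u) ^ (-σ) ≤
      2 ^ σ * ((1 + u.re ^ 2) ^ (-σ / 2) * (u.im ^ (σ - 2) * (1 + u.im ^ 2) ^ (-σ / 2))) := by
  have hy := u.im_pos
  have hc : Real.cosh (dist I u) = (2 * u.im)⁻¹ * (1 + u.re ^ 2 + u.im ^ 2) := by
    rw [UpperHalfPlane.cosh_dist', I_re, I_im]; field_simp; ring
  have h1 : Real.cosh (dist I u) ^ (-σ) =
      2 ^ σ * u.im ^ σ * (1 + u.re ^ 2 + u.im ^ 2) ^ (-σ) := by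
    rw [hc, Real.mul_rpow (by positivity) (by positivity), Real.inv_rpow (by positivity),
      Real.rpow_neg (by positivity), inv_inv, Real.mul_rpow (by positivity) hy.le]
  -- The exponent is split into halves, and the base is bounded below once by `1 + x²` and once by
  -- `1 + y²`, which separates the variables.
  have h2 : (1 + u.re ^ 2 + u.im ^ 2) ^ (-σ) ≤
      (1 + u.re ^ 2) ^ (-σ / 2) * (1 + u.im ^ 2) ^ (-σ / 2) := by
    have : -σ = -σ / 2 + -σ / 2 := by ring
    rw [this, Real.rpow_add (by positivity), ← this]
    gcongr ?_ * ?_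
    · exact Real.rpow_le_rpow_of_nonpos (by positivity) (by nlinarith) (by linarith)
    · exact Real.rpow_le_rpow_of_nonpos (by positivity) (by nlinarith) (by linarith)
  have h3 : u.im ^ (σ - 2) = (1 / u.im) ^ 2 * u.im ^ σ := by
    rw [Real.rpow_sub hy, Real.rpow_two]; field_simp
  rw [h1, h3]
  calc _ = (1 / u.im) ^ 2 * (2 ^ σ * u.im ^ σ) * (1 + u.re ^ 2 + u.im ^ 2) ^ (-σ) := by ring
    _ ≤ (1 / u.im) ^ 2 * (2 ^ σ * u.im ^ σ) *
        ((1 + u.re ^ 2) ^ (-σ / 2) * (1 + u.im ^ 2) ^ (-σ / 2)) := by gcongr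
    _ = _ := by ring

/-- After the bound by a product, Tonelli reduces the area integral to two one-variable integrals,
both finite for `σ > 1`. -/
lemma lintegral_cosh_dist_I_rpow_lt_top {σ : ℝ} (hσ : 1 < σ) :
    ∫⁻ u : ℍ, ENNReal.ofReal (Real.cosh (dist I u) ^ (-σ)) < ⊤ := by
  set g : ℝ → ENNReal := fun x => ENNReal.ofReal ((1 + x ^ 2) ^ (-σ / 2)) with hg
  set h : ℝ → ENNReal :=
    (Set.Ioi 0).indicator fun y => ENNReal.ofReal (y ^ (σ - 2) * (1 + y ^ 2) ^ (-σ / 2)) with hh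
  have hgm : Measurable g := by fun_prop
  have hhm : Measurable h := Measurable.indicator (by fun_prop) measurableSet_Ioi
  have hgi : ∫⁻ x, g x < ⊤ := by
    have := integrable_rpow_neg_one_add_norm_sq (E := ℝ) (μ := volume) (r := σ) (by simpa using hσ)
    simp only [Real.norm_eq_abs, sq_abs] at this
    exact this.lintegral_lt_top
  have hhi : ∫⁻ y, h y < ⊤ := by
    rw [hh, lintegral_indicator measurableSet_Ioi]
    exact (integrableOn_rpow_mul_one_add_sq_rpow hσ).lintegral_lt_top
  have hprod : ∫⁻ z : ℂ, g z.re * h z.im < ⊤ := by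
    have := Complex.volume_preserving_equiv_real_prod.lintegral_comp
      (f := fun p : ℝ × ℝ => g p.1 * h p.2) (by fun_prop)
    simp only [Complex.measurableEquivRealProd_apply] at this
    rw [this, Measure.volume_eq_prod, lintegral_prod_mul hgm.aemeasurable hhm.aemeasurable]
    exact ENNReal.mul_lt_top hgi hhi
  have hm : Measurable fun z : ℂ => ENNReal.ofReal ((1 / z.im) ^ 2) := by fun_prop
  rw [volume_def]
  have hd : ∀ u : ℍ, (((1 / NNReal.mk u.im u.im_pos.le : NNReal) ^ 2 : NNReal) : ENNReal) =
      ENNReal.ofReal ((1 / (u : ℂ).im) ^ 2) := fun u => by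
    rw [ENNReal.ofReal, ENNReal.coe_inj, Real.toNNReal_of_nonneg (by positivity)]
    ext; simp
  simp_rw [hd]
  have hF : Measurable fun u : ℍ => ENNReal.ofReal (Real.cosh (dist I u) ^ (-σ)) :=
    Continuous.measurable (ENNReal.continuous_ofReal.comp
      (Continuous.rpow_const (by fun_prop) fun u => Or.inl (Real.cosh_pos _).ne'))
  have hD : Measurable fun u : ℍ => ENNReal.ofReal ((1 / (u : ℂ).im) ^ 2) := hm.comp measurable_coe
  rw [lintegral_withDensity_eq_lintegral_mul _ hD hF]
  calc _ ≤ ∫⁻ u : ℍ, ENNReal.ofReal (2 ^ σ) * (g (u : ℂ).re * h (u : ℂ).im)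
          ∂(volume.comap UpperHalfPlane.coe) := by
        refine lintegral_mono fun u => ?_
        have hu : (u : ℂ).im ∈ Set.Ioi (0 : ℝ) := u.im_pos
        rw [hh, hg, Set.indicator_of_mem hu, ← ENNReal.ofReal_mul (by positivity),
          ← ENNReal.ofReal_mul (by positivity), Pi.mul_apply, ← ENNReal.ofReal_mul (by positivity)]
        exact ENNReal.ofReal_le_ofReal (cosh_dist_I_rpow_le (by linarith) u)
    _ = ∫⁻ z in Set.range UpperHalfPlane.coe, ENNReal.ofReal (2 ^ σ) * (g z.re * h z.im) := by
        rw [← measurableEmbedding_coe.map_comap, measurableEmbedding_coe.lintegral_map]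
    _ ≤ ∫⁻ z : ℂ, ENNReal.ofReal (2 ^ σ) * (g z.re * h z.im) := setLIntegral_le_lintegral _ _
    _ = ENNReal.ofReal (2 ^ σ) * ∫⁻ z : ℂ, g z.re * h z.im := by
        rw [lintegral_const_mul]
        exact (hgm.comp Complex.measurable_re).mul (hhm.comp Complex.measurable_im)
    _ < ⊤ := ENNReal.mul_lt_top ENNReal.ofReal_lt_top hprod

/-- Unit balls have area bounded below. -/
lemma exists_le_volume_ball : ∃ V : ENNReal, V ≠ 0 ∧
    ∀ z : ℍ, V ≤ volume (Metric.ball z 1) := by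
  have hs : 0 < Real.sinh 1 := Real.sinh_pos_iff.2 one_pos
  -- The ball is a Euclidean disc of radius `z.im * sinh 1`, on which the height is at most `z.im *
  -- exp 1`. In area times minimal density `z.im` cancels.
  refine ⟨ENNReal.ofReal ((Real.sinh 1 / Real.exp 1) ^ 2) * NNReal.pi,
    mul_ne_zero ?_ ?_, fun z => ?_⟩
  · exact (ENNReal.ofReal_pos.2 (by positivity)).ne'
  · exact ENNReal.coe_ne_zero.2 NNReal.pi_ne_zero
  have hz := z.im_pos
  rw [volume_eq_lintegral]
  calc ENNReal.ofReal ((Real.sinh 1 / Real.exp 1) ^ 2) * NNReal.pi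
      = ENNReal.ofReal ((1 / (z.im * Real.exp 1)) ^ 2) *
          volume (UpperHalfPlane.coe '' Metric.ball z 1) := by
        rw [image_coe_ball, Complex.volume_ball, ← ENNReal.ofReal_pow (by positivity), ← mul_assoc,
          ← ENNReal.ofReal_mul (by positivity)]
        congr 2
        field_simp
    _ = ∫⁻ _ in UpperHalfPlane.coe '' Metric.ball z 1,
          ENNReal.ofReal ((1 / (z.im * Real.exp 1)) ^ 2) := by
        rw [setLIntegral_const]
    _ ≤ _ := by
        refine setLIntegral_mono' (measurableEmbedding_coe.measurableSet_image.2
          Metric.isOpen_ball.measurableSet) ?_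
        rintro _ ⟨u, hu, rfl⟩
        have hu0 : 0 < (u : ℂ).im := u.im_pos
        rw [ENNReal.ofReal, ENNReal.coe_le_coe, Real.toNNReal_le_iff_le_coe]
        push_cast
        rw [Real.norm_of_nonneg hu0.le]
        refine pow_le_pow_left₀ (by positivity) (one_div_le_one_div_of_le hu0 ?_) 2
        refine (im_le_im_mul_exp_dist u z).trans ?_
        gcongr
        exact (Metric.mem_ball.1 hu).le

/-! ### Convergence of the Poincaré series by area comparison -/

section Discrete

variable (Γ : Subgroup PSL(2, ℝ)) [DiscreteTopology Γ]

/-- Each term is at most `C / V` times the integral of `F` over the unit ball about its orbit point,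
and every point lies in at most `N` of these balls. -/
lemma summable_cosh_dist_I_rpow {σ : ℝ} (hσ : 1 < σ) (w : ℍ) :
    Summable fun η : Γ => Real.cosh (dist I (η • w)) ^ (-σ) := by
  classical
  have : Countable Γ := countable_of_discrete Γ
  obtain ⟨N, hN⟩ := exists_card_le Γ w
  obtain ⟨V, hV0, hV⟩ := exists_le_volume_ball
  set F : ℍ → ENNReal := fun u => ENNReal.ofReal (Real.cosh (dist I u) ^ (-σ)) with hF
  have hFm : Measurable F := Continuous.measurable (ENNReal.continuous_ofReal.comp
      (Continuous.rpow_const (by fun_prop) fun u => Or.inl (Real.cosh_pos _).ne'))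
  set C : ENNReal := ENNReal.ofReal ((2 * Real.cosh 1) ^ σ) with hC
  have hpt : ∀ η : Γ, F (η • w) * V ≤ C * ∫⁻ u, (Metric.ball (η • w) 1).indicator F u := by
    intro η
    calc F (η • w) * V ≤ F (η • w) * volume (Metric.ball (η • w) 1) := by gcongr; exact hV _
      _ = ∫⁻ _ in Metric.ball (η • w) 1, F (η • w) := by rw [setLIntegral_const]
      _ ≤ ∫⁻ u in Metric.ball (η • w) 1, C * F u := by
          refine setLIntegral_mono' Metric.isOpen_ball.measurableSet fun u hu => ?_
          have hc := Real.cosh_pos 1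
          rw [hC, hF, ← ENNReal.ofReal_mul (by positivity)]
          refine ENNReal.ofReal_le_ofReal (cosh_dist_rpow_le (by linarith) _ _ _ ?_)
          rw [dist_comm]; exact (Metric.mem_ball.1 hu).le
      _ = _ := by
          rw [lintegral_const_mul _ hFm, lintegral_indicator Metric.isOpen_ball.measurableSet]
  have hsum : ∑' η : Γ, F (η • w) * V ≤ C * (N * ∫⁻ u, F u) := by
    calc _ ≤ ∑' η : Γ, C * ∫⁻ u, (Metric.ball (η • w) 1).indicator F u :=
          ENNReal.tsum_le_tsum hpt
      _ = C * ∫⁻ u, ∑' η : Γ, (Metric.ball (η • w) 1).indicator F u := by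
          rw [ENNReal.tsum_mul_left, lintegral_tsum fun η =>
            (hFm.indicator Metric.isOpen_ball.measurableSet).aemeasurable]
      _ ≤ C * ∫⁻ u, N * F u := by
          gcongr with u
          obtain ⟨T, hT, hTN⟩ := hN u
          rw [tsum_eq_sum (s := T) fun η hη =>
            Set.indicator_of_notMem (fun h => hη (hT η h)) F]
          calc _ ≤ ∑ η ∈ T, F u := Finset.sum_le_sum fun η _ => Set.indicator_le_self _ _ _
            _ = T.card * F u := by rw [Finset.sum_const, nsmul_eq_mul]
            _ ≤ N * F u := by gcongr
      _ = _ := by rw [lintegral_const_mul _ hFm]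
  have hfin : ∑' η : Γ, F (η • w) ≠ ⊤ := by
    intro htop
    rw [ENNReal.tsum_mul_right, htop, ENNReal.top_mul hV0, top_le_iff] at hsum
    exact ENNReal.mul_ne_top ENNReal.ofReal_ne_top (ENNReal.mul_ne_top (ENNReal.natCast_ne_top N)
      (lintegral_cosh_dist_I_rpow_lt_top hσ).ne) hsum
  refine (ENNReal.summable_toReal hfin).congr fun η => ?_
  rw [hF, ENNReal.toReal_ofReal (Real.rpow_nonneg (Real.cosh_pos _).le _)]

/-- The Poincaré series of a discrete group converges for exponents larger than one. -/
lemma summable_cosh_dist_rpow {σ : ℝ} (hσ : 1 < σ) (z w : ℍ) :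
    Summable fun η : Γ => Real.cosh (dist z (η • w)) ^ (-σ) := by
  refine Summable.of_nonneg_of_le (fun η => Real.rpow_nonneg (Real.cosh_pos _).le _) (fun η => ?_)
    ((summable_cosh_dist_I_rpow Γ hσ w).mul_left ((2 * Real.cosh (dist z I)) ^ σ))
  rw [dist_comm z, dist_comm I (η • w)]
  exact cosh_dist_rpow_le (by linarith) _ _ _ le_rfl

end Discrete

/-! ### The centralizer of a primitive hyperbolic element -/

lemma mk_neg_eq (A : SL(2, ℝ)) : (QuotientGroup.mk (-A) : PSL(2, ℝ)) = QuotientGroup.mk A := by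
  rw [eq_comm, QuotientGroup.eq, show A⁻¹ * -A = -1 by simp]
  exact Subgroup.mem_center_iff.mpr fun B => by simp

lemma exists_mk_eq_diagExp_of_pos (A : SL(2, ℝ)) (hb : A 0 1 = 0) (hc : A 1 0 = 0)
    (ha : 0 < A 0 0) : ∃ t, A = diagExp t := by
  have hdet : A 0 0 * A 1 1 = 1 := by
    have := A.det_coe
    rw [Matrix.det_fin_two, hb, zero_mul, sub_zero] at this
    exact this
  refine ⟨2 * Real.log (A 0 0), ?_⟩
  have h1 : Real.exp (2 * Real.log (A 0 0) / 2) = A 0 0 := by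
    rw [mul_div_cancel_left₀ _ two_ne_zero, Real.exp_log ha]
  have h2 : Real.exp (-(2 * Real.log (A 0 0)) / 2) = A 1 1 := by
    rw [neg_div, Real.exp_neg, h1]; exact inv_eq_of_mul_eq_one_right hdet
  ext i j
  fin_cases i <;> fin_cases j
  · exact h1.symm
  · exact hb
  · exact hc
  · exact h2.symm

/-- Commuting in `PSL(2, ℝ)` is commuting up to a sign in `SL(2, ℝ)`. For either sign the
off-diagonal entries vanish since `exp (ℓ / 2) > exp (-ℓ / 2) > 0`; replacing `A` by `-A` makes the
diagonal positive. -/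
lemma exists_eq_mk_diagExp_of_commute {ℓ : ℝ} (hℓ : 0 < ℓ) (g : PSL(2, ℝ))
    (hg : g * (QuotientGroup.mk (diagExp ℓ) : PSL(2, ℝ)) = QuotientGroup.mk (diagExp ℓ) * g) :
    ∃ t, g = QuotientGroup.mk (diagExp t) := by
  obtain ⟨A, rfl⟩ := QuotientGroup.mk_surjective g
  rw [← QuotientGroup.mk_mul, ← QuotientGroup.mk_mul, QuotientGroup.eq] at hg
  obtain ⟨r, hr, hA⟩ := Matrix.SpecialLinearGroup.mem_center_iff.mp hg
  have hr2 : r ^ 2 = 1 := by simpa using hr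
  have hmat : (diagExp ℓ : SL(2, ℝ)).1 * A.1 = (A.1 * (diagExp ℓ).1) * Matrix.scalar (Fin 2) r := by
    rw [hA]
    have : diagExp ℓ * A = (A * diagExp ℓ) * ((A * diagExp ℓ)⁻¹ * (diagExp ℓ * A)) := by group
    exact congrArg Subtype.val this
  have h01 := congrFun (congrFun hmat 0) 1
  have h10 := congrFun (congrFun hmat 1) 0
  simp [diagExp, Matrix.mul_apply, Fin.sum_univ_two] at h01 h10
  have hlt : Real.exp (-ℓ / 2) < Real.exp (ℓ / 2) := Real.exp_lt_exp.2 (by linarith)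
  have hpos := Real.exp_pos (-ℓ / 2)
  have hr1 : r = 1 ∨ r = -1 := by simpa using hr2
  have hb : A 0 1 = 0 := by
    rcases hr1 with h | h <;> subst h <;> nlinarith
  have hc : A 1 0 = 0 := by
    rcases hr1 with h | h <;> subst h <;> nlinarith
  have ha : A 0 0 ≠ 0 := by
    intro h
    have := A.det_coe
    rw [Matrix.det_fin_two, hb] at this
    have h' : A.1 0 0 = 0 := h
    simp [h'] at this
  rcases lt_or_gt_of_ne ha with h | h
  · obtain ⟨t, ht⟩ := exists_mk_eq_diagExp_of_pos (-A) (by simpa using hb) (by simpa using hc)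
      (by simpa using h)
    exact ⟨t, by rw [← ht, mk_neg_eq]⟩
  · obtain ⟨t, ht⟩ := exists_mk_eq_diagExp_of_pos A hb hc h
    exact ⟨t, by rw [ht]⟩

lemma diagExp_add (t u : ℝ) : diagExp (t + u) = diagExp t * diagExp u := by
  apply Subtype.ext
  rw [Matrix.SpecialLinearGroup.coe_mul]
  simp only [diagExp, Matrix.mul_fin_two, mul_zero, zero_mul, add_zero, zero_add,
    ← Real.exp_add]
  congr 3 <;> ring_nf

section Scaling

variable {γ : PSL(2, ℝ)} (S : Scaling γ)

/-- The hyperbolic translations along the axis of `γ`. -/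
noncomputable def Scaling.translation (S : Scaling γ) : Multiplicative ℝ →* PSL(2, ℝ) :=
  MonoidHom.mk' (fun t => S.σ * QuotientGroup.mk (diagExp t.toAdd) * S.σ⁻¹) fun t u => by
    rw [toAdd_mul, diagExp_add, QuotientGroup.mk_mul]; group

lemma Scaling.translation_apply (t : ℝ) :
    S.translation (Multiplicative.ofAdd t) = S.σ * QuotientGroup.mk (diagExp t) * S.σ⁻¹ := rfl

lemma Scaling.translation_length : S.translation (Multiplicative.ofAdd S.ℓ) = γ := by
  rw [S.translation_apply, ← S.conj_eq]; group

lemma Scaling.translation_smul_path (t u : ℝ) :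
    S.translation (Multiplicative.ofAdd t) • S.path u = S.path (u + t) := by
  rw [S.translation_apply, Scaling.path, Scaling.path, ← mul_smul, inv_mul_cancel_right, mul_smul,
    mk_smul, diagExp_smul_expI]

lemma Scaling.path_injective : Function.Injective S.path := fun t u h => by
  have := S.dist_path_path t u
  rw [h, dist_self, eq_comm, abs_eq_zero, sub_eq_zero] at this
  exact this

lemma Scaling.translation_injective : Function.Injective S.translation := fun t u h => by
  have h1 := S.translation_smul_path t.toAdd 0
  rw [ofAdd_toAdd, h, ← ofAdd_toAdd u, S.translation_smul_path] at h1
  simpa using (S.path_injective h1).symm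

lemma Scaling.exists_translation_eq (g : PSL(2, ℝ)) (hg : g * γ = γ * g) :
    ∃ t, S.translation t = g := by
  have h : (S.σ⁻¹ * g * S.σ) * (QuotientGroup.mk (diagExp S.ℓ) : PSL(2, ℝ)) =
      QuotientGroup.mk (diagExp S.ℓ) * (S.σ⁻¹ * g * S.σ) := by
    rw [← S.conj_eq]
    calc _ = S.σ⁻¹ * (g * γ) * S.σ := by group
      _ = _ := by rw [hg]; group
  obtain ⟨t, ht⟩ := exists_eq_mk_diagExp_of_commute S.ℓ_pos _ h
  exact ⟨Multiplicative.ofAdd t, by rw [S.translation_apply, ← ht]; group⟩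

/-- The translations along the axis that belong to a discrete group form a cyclic group. -/
lemma Scaling.exists_comap_translation_eq (Γ : Subgroup PSL(2, ℝ)) [DiscreteTopology Γ] :
    ∃ b, Γ.comap S.translation = Subgroup.closure {b} := by
  -- Such translations move `S.path 0` by less than 1, so proper discontinuity leaves finitely many,
  -- and 0 is isolated from them.
  set X : Set ℝ := {t | S.translation (Multiplicative.ofAdd t) ∈ Γ ∧ t ∈ Set.Ioo 0 1} with hX
  have hfin : X.Finite := by
    have h := ((finite_setOf_dist_smul_le Γ (S.path 0) 1).image Subtype.val).preimage
      (S.translation_injective.comp Multiplicative.ofAdd.injective).injOn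
    refine h.subset fun t ht => ⟨⟨_, ht.1⟩, ?_, rfl⟩
    change dist (S.path 0) (S.translation (Multiplicative.ofAdd t) • S.path 0) ≤ 1
    rw [S.translation_smul_path, S.dist_path_path, zero_add, zero_sub, abs_neg,
      abs_of_pos ht.2.1]
    exact ht.2.2.le
  have h0 : Xᶜ ∈ nhds (0 : ℝ) :=
    hfin.isClosed.isOpen_compl.mem_nhds fun h => lt_irrefl _ h.2.1
  obtain ⟨ε, hε, hball⟩ := Metric.mem_nhds_iff.1 h0
  refine Subgroup.cyclic_of_isolated_one (a := Multiplicative.ofAdd (min ε 1))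
    (show (0 : ℝ) < min ε 1 by positivity) (Set.disjoint_left.2 fun t ht hI => ?_)
  have h1 : 0 < t.toAdd := hI.1
  have h2 : t.toAdd < min ε 1 := hI.2
  refine hball (a := t.toAdd) ?_ ⟨ht, h1, h2.trans_le (min_le_right _ _)⟩
  rw [Metric.mem_ball, dist_zero_right, Real.norm_of_nonneg h1.le]
  exact h2.trans_le (min_le_left _ _)

end Scaling

/-- The centralizer of a primitive hyperbolic element of a discrete group is generated by it. -/
lemma stab_eq_centralizer (Γ : Subgroup PSL(2, ℝ)) [DiscreteTopology Γ] (γ : Γ)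
    (hprim : IsPrimitive γ) (S : Scaling (γ : PSL(2, ℝ))) :
    stab γ = Subgroup.centralizer {γ} := by
  apply le_antisymm
  · rw [Subgroup.zpowers_le, Subgroup.mem_centralizer_singleton_iff]
  intro g hg
  rw [Subgroup.mem_centralizer_singleton_iff] at hg
  obtain ⟨b, hb⟩ := S.exists_comap_translation_eq Γ
  have hmem : ∀ t, S.translation t ∈ Γ → ∃ n : ℤ, b ^ n = t := fun t ht => by
    have h : t ∈ Γ.comap S.translation := ht
    rwa [hb, Subgroup.mem_closure_singleton] at h
  have hbΓ : S.translation b ∈ Γ := by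
    change b ∈ Γ.comap S.translation
    rw [hb]; exact Subgroup.mem_closure_singleton_self b
  set δ : Γ := ⟨S.translation b, hbΓ⟩ with hδ
  obtain ⟨t, ht⟩ := S.exists_translation_eq (g : PSL(2, ℝ)) (by
    have := congrArg Subtype.val hg
    simpa using this)
  obtain ⟨m, hm⟩ := hmem t (by rw [ht]; exact g.2)
  obtain ⟨n, hn⟩ := hmem _ (by rw [S.translation_length]; exact γ.2)
  have hgδ : g = δ ^ m := by
    apply Subtype.ext
    rw [Subgroup.coe_zpow, hδ, ← map_zpow, hm, ht]
  have hγδ : γ = δ ^ n := by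
    apply Subtype.ext
    rw [Subgroup.coe_zpow, hδ, ← map_zpow, hn, S.translation_length]
  have hn0 : n ≠ 0 := by
    rintro rfl
    have : (0 : ℝ) = S.ℓ := by simpa using congrArg Multiplicative.toAdd hn
    exact S.ℓ_pos.ne this
  have hn1 : n.natAbs = 1 := by
    by_contra h
    have h2 : 2 ≤ n.natAbs := by omega
    rcases Int.natAbs_eq n with h' | h'
    · exact hprim δ _ h2 (by rw [hγδ, ← zpow_natCast, ← h'])
    -- Primitivity speaks of natural exponents only, so a negative `n` is handled through the
    -- inverse generator.
    · exact hprim δ⁻¹ _ h2 (by rw [hγδ, ← zpow_natCast, inv_zpow', ← h'])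
  rw [Subgroup.mem_zpowers_iff]
  rcases Int.natAbs_eq n with h' | h' <;> rw [hn1] at h'
  · exact ⟨m, by rw [hgδ, hγδ, h']; simp⟩
  · exact ⟨-m, by rw [hgδ, hγδ, h']; simp⟩

/-! ### Unfolding -/

/-- The translates of `[0, ℓ]` by multiples of `ℓ` tile the line; rescaling by `ℓ` reduces this to
unit intervals. -/
lemma hasSum_intervalIntegral_comp_add_mul {ℓ : ℝ} (hℓ : 0 < ℓ) {G : ℝ → ℂ} (hG : Integrable G) :
    HasSum (fun n : ℤ => ∫ t in (0 : ℝ)..ℓ, G (t + n * ℓ)) (∫ t, G t) := by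
  have h := (hG.comp_mul_left' hℓ.ne').hasSum_intervalIntegral_comp_add_int.const_smul ℓ
  have e1 : ∀ n : ℤ, ℓ • ∫ x in (0 : ℝ)..1, G (ℓ * (x + n)) =
      ∫ t in (0 : ℝ)..ℓ, G (t + n * ℓ) := fun n => by
    have := intervalIntegral.smul_integral_comp_mul_left (a := 0) (b := 1)
      (fun t => G (t + n * ℓ)) ℓ
    rw [mul_zero, mul_one] at this
    rw [← this]
    congr 2
    funext x
    congr 1
    ring
  have e2 : ℓ • ∫ x, G (ℓ * x) = ∫ t, G t := by
    rw [Measure.integral_comp_mul_left, abs_of_pos (inv_pos.2 hℓ), smul_smul,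
      mul_inv_cancel₀ hℓ.ne', one_smul]
  simp only [e1] at h
  rwa [e2] at h

lemma Scaling.zpow_injective {Γ : Subgroup PSL(2, ℝ)} {γ : Γ} (S : Scaling (γ : PSL(2, ℝ))) :
    Function.Injective fun n : ℤ => γ ^ n := fun n m h => by
  have h1 : (γ : PSL(2, ℝ)) ^ n = (γ : PSL(2, ℝ)) ^ m := by
    simpa using congrArg Subtype.val h
  have h2 := S.zpow_smul_path n 0
  rw [h1, S.zpow_smul_path] at h2
  have h3 := S.path_injective h2
  have := S.ℓ_pos.ne'
  simpa [this] using h3.symm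

/-- Every element of `Γ` is uniquely `a⁻¹ γ ^ n` with `a` in a set of representatives of
`Γ_γ \ Γ`. -/
lemma bijective_inv_out_mul_zpow {Γ : Subgroup PSL(2, ℝ)} {γ : Γ} (S : Scaling (γ : PSL(2, ℝ))) :
    Function.Bijective fun p : Cosets γ × ℤ => p.1.out⁻¹ * γ ^ p.2 := by
  constructor
  · rintro ⟨q, n⟩ ⟨q', m⟩ h
    simp only at h
    have hq : q = q' := by
      rw [← q.out_eq, ← q'.out_eq]
      refine Quotient.sound (QuotientGroup.rightRel_apply.2 ⟨m - n, ?_⟩)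
      simp only
      rw [zpow_sub, eq_comm, eq_mul_inv_iff_mul_eq, mul_assoc, h, mul_inv_cancel_left]
    subst hq
    exact Prod.ext rfl (S.zpow_injective (mul_left_cancel h))
  · intro η
    obtain ⟨n, hn⟩ := QuotientGroup.rightRel_apply.1
      (Quotient.mk_out (s := QuotientGroup.rightRel (stab γ)) η⁻¹)
    -- The representative enters inverted, so the coset of `η⁻¹` is the one to take.
    refine ⟨(Quotient.mk _ η⁻¹, -n), ?_⟩
    simp only at hn ⊢
    rw [zpow_neg, hn]
    group

/-! ### Termwise integration and regrouping by cosets -/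

section Main

variable {Γ : Subgroup PSL(2, ℝ)} {γ : Γ} (S : Scaling (γ : PSL(2, ℝ))) {s : ℂ}

lemma norm_kernelTerm (s : ℂ) (z w : ℍ) (η : Γ) :
    ‖kernelTerm Γ s z w η‖ = Real.cosh (dist z (η • w)) ^ (-s.re) := by
  rw [kernelTerm, Complex.norm_cpow_eq_rpow_re_of_pos (Real.cosh_pos _), Complex.neg_re]

lemma continuous_kernelTerm_path (s : ℂ) (z : ℍ) (η : Γ) :
    Continuous fun t => kernelTerm Γ s z (S.path t) η := by
  have h : Continuous fun t => η • S.path t :=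
    (isometry_smul ℍ (η : PSL(2, ℝ))).continuous.comp S.continuous_path
  refine Continuous.cpow ?_ continuous_const fun t => Or.inl ?_
  · exact Complex.continuous_ofReal.comp (Real.continuous_cosh.comp (continuous_const.dist h))
  · exact Real.cosh_pos _

/-- A majorant independent of `t`, serving both the continuity of the kernel along the geodesic and
dominated convergence. -/
lemma norm_kernelTerm_path_le (hs : 0 ≤ s.re) (z : ℍ) (η : Γ) {t : ℝ} (ht : t ∈ Set.Icc 0 S.ℓ) :
    ‖kernelTerm Γ s z (S.path t) η‖ ≤
      (2 * Real.cosh S.ℓ) ^ s.re * Real.cosh (dist z (η • S.path 0)) ^ (-s.re) := by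
  rw [norm_kernelTerm]
  refine cosh_dist_rpow_le hs _ _ _ ?_
  have e : dist (η • S.path t) (η • S.path 0) = dist (S.path t) (S.path 0) :=
    dist_smul (η : PSL(2, ℝ)) _ _
  rw [e, S.dist_path_path, sub_zero, abs_of_nonneg ht.1]
  exact ht.2

lemma lineIntegrand_kernel (z : ℍ) (t : ℝ) :
    lineIntegrand Γ (kernel Γ s (proj Γ z)) S.path t =
      ∑' η, kernelTerm Γ s z (S.path t) η := by
  rw [lineIntegrand, S.hypSpeed_path, Complex.ofReal_one, mul_one]
  rfl

/-- The integral of a term of the unfolded series over the whole axis. -/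
lemma hasSum_integral_kernelTerm_coset (hs : 0 < s.re) (z : ℍ) (q : Cosets γ) :
    HasSum (fun n : ℤ => ∫ t in (0 : ℝ)..S.ℓ, kernelTerm Γ s z (S.path t) (q.out⁻¹ * γ ^ n))
      ((2 : ℂ) ^ (s - 1) * Complex.Gamma (s / 2) ^ 2 / Complex.Gamma s * eisTerm S s z q) := by
  set a := q.out with ha
  -- The parameter of the foot of the perpendicular from `a • z` to the axis; it disappears by
  -- translation invariance of the integral.
  set c := Real.log ‖((S.σ⁻¹ • (a • z) : ℍ) : ℂ)‖ with hc
  set G : ℝ → ℂ := fun t => eisTerm S s z q * (Real.cosh (t - c) : ℂ) ^ (-s) with hG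
  have hq : eisTerm S s z q = (Real.cosh (Metric.infDist (a • z) S.axis) : ℂ) ^ (-s) := by
    rw [← q.out_eq]; rfl
  have hterm : ∀ (n : ℤ) (t : ℝ),
      kernelTerm Γ s z (S.path t) (a⁻¹ * γ ^ n) = G (t + n * S.ℓ) := fun n t => by
    have h1 : (a⁻¹ * γ ^ n) • S.path t = (a : PSL(2, ℝ))⁻¹ • S.path (t + n * S.ℓ) := by
      rw [← S.zpow_smul_path, mul_smul]; rfl
    have h2 : dist z ((a⁻¹ * γ ^ n) • S.path t) = dist (a • z) (S.path (t + n * S.ℓ)) := by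
      rw [h1, dist_smul_left_eq, inv_inv]; rfl
    rw [kernelTerm, h2, S.cosh_dist_path, Complex.ofReal_mul,
      Complex.mul_cpow_ofReal_nonneg (Real.cosh_pos _).le (Real.cosh_pos _).le, hG, hq]
  have hint : Integrable G := ((integrable_cosh_cpow hs).comp_sub_right c).const_mul _
  have hval : ∫ t, G t =
      (2 : ℂ) ^ (s - 1) * Complex.Gamma (s / 2) ^ 2 / Complex.Gamma s * eisTerm S s z q := by
    rw [hG, integral_const_mul, integral_sub_right_eq_self
      (fun t : ℝ => (Real.cosh t : ℂ) ^ (-s)) c, integral_cosh_cpow hs, mul_comm]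
  simp only [hterm]
  rw [← hval]
  exact hasSum_intervalIntegral_comp_add_mul S.ℓ_pos hint

variable [DiscreteTopology Γ]

lemma summable_kernelTerm (hs : 1 < s.re) (z w : ℍ) : Summable (kernelTerm Γ s z w) :=
  Summable.of_norm ((summable_cosh_dist_rpow Γ hs z w).congr fun η =>
    (norm_kernelTerm s z w η).symm)

lemma intervalIntegrable_lineIntegrand_kernel (hs : 1 < s.re) (z : ℍ) :
    IntervalIntegrable (lineIntegrand Γ (kernel Γ s (proj Γ z)) S.path) volume 0 S.ℓ := by
  refine ContinuousOn.intervalIntegrable ?_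
  rw [Set.uIcc_of_le S.ℓ_pos.le]
  refine ContinuousOn.congr ?_ fun t _ => lineIntegrand_kernel S z t
  exact continuousOn_tsum (fun η => (continuous_kernelTerm_path S s z η).continuousOn)
    ((summable_cosh_dist_rpow Γ hs z (S.path 0)).mul_left _)
    fun η t ht => norm_kernelTerm_path_le S (by linarith) z η ht

lemma hasSum_integral_kernelTerm (hs : 1 < s.re) (z : ℍ) :
    HasSum (fun η : Γ => ∫ t in (0 : ℝ)..S.ℓ, kernelTerm Γ s z (S.path t) η)
      (closedGeodesicIntegral Γ S (kernel Γ s (proj Γ z))) := by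
  have : Countable Γ := countable_of_discrete Γ
  refine intervalIntegral.hasSum_integral_of_dominated_convergence
    (fun η _ => (2 * Real.cosh S.ℓ) ^ s.re * Real.cosh (dist z (η • S.path 0)) ^ (-s.re))
    (fun η => (continuous_kernelTerm_path S s z η).aestronglyMeasurable)
    (fun η => Filter.Eventually.of_forall fun t ht => ?_)
    (Filter.Eventually.of_forall fun t _ =>
      (summable_cosh_dist_rpow Γ hs z (S.path 0)).mul_left _)
    intervalIntegrable_const
    (Filter.Eventually.of_forall fun t _ => ?_)
  · rw [Set.uIoc_of_le S.ℓ_pos.le] at ht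
    exact norm_kernelTerm_path_le S (by linarith) z η ⟨ht.1.le, ht.2⟩
  · rw [lineIntegrand_kernel]
    exact (summable_kernelTerm hs z (S.path t)).hasSum

/-- The sum over Γ, reindexed by pairs of a coset and an integer, is summed first over the integers.
-/
lemma hasSum_eisTerm (hs : 1 < s.re) (z : ℍ) :
    HasSum (fun q => (2 : ℂ) ^ (s - 1) * Complex.Gamma (s / 2) ^ 2 / Complex.Gamma s *
      eisTerm S s z q) (closedGeodesicIntegral Γ S (kernel Γ s (proj Γ z))) :=
  ((Equiv.ofBijective _ (bijective_inv_out_mul_zpow S)).hasSum_iff.2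
    (hasSum_integral_kernelTerm S hs z)).prod_fiberwise
      fun q => hasSum_integral_kernelTerm_coset S (by linarith) z q

end Main

end HypEis

theorem mainTheorem6 (Γ : Subgroup PSL(2, ℝ)) (hΓ : IsFuchsianFirstKind Γ)
    (γ : Γ) (hγ : IsHyperbolic (γ : PSL(2, ℝ))) (hprim : IsPrimitive γ)
    (S : Scaling (γ : PSL(2, ℝ))) (s : ℂ) (hs : 1 < s.re) :
    -- `Γ_γ = ⟨γ⟩` is the stabilizer of `γ` in `Γ`
    stab γ = Subgroup.centralizer {γ} ∧
    ∀ z : ℍ,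
      -- absolute convergence of the series and of the integral
      (∀ w : ℍ, Summable (kernelTerm Γ s z w)) ∧
      Summable (eisTerm S s z) ∧
      IntervalIntegrable (lineIntegrand Γ (kernel Γ s (proj Γ z)) S.path) volume 0 S.ℓ ∧
      -- the integral formula
      closedGeodesicIntegral Γ S (fun w => kernel Γ s (proj Γ z) w) =
        (2 : ℂ) ^ (s - 1) * Complex.Gamma (s / 2) ^ 2 / Complex.Gamma s *
          eisenstein S s (proj Γ z) := by
  have := hΓ.discrete
  refine ⟨stab_eq_centralizer Γ γ hprim S, fun z => ?_⟩
  have hsum := hasSum_eisTerm S hs z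
  have hs2 : 0 < (s / 2).re := by simp; linarith
  -- A nonzero factor can be cancelled from the unfolded sum, which yields convergence of the
  -- Eisenstein series.
  have hne : (2 : ℂ) ^ (s - 1) * Complex.Gamma (s / 2) ^ 2 / Complex.Gamma s ≠ 0 :=
    div_ne_zero (mul_ne_zero (by simp [Complex.cpow_eq_zero_iff])
      (pow_ne_zero 2 (Complex.Gamma_ne_zero_of_re_pos hs2)))
      (Complex.Gamma_ne_zero_of_re_pos (by linarith))
  have hE : Summable (eisTerm S s z) := (summable_mul_left_iff hne).1 hsum.summable
  refine ⟨fun w => summable_kernelTerm hs z w, hE,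
    intervalIntegrable_lineIntegrand_kernel S hs z, ?_⟩
  exact hsum.unique (hE.hasSum.mul_left _)
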